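/- Let $F$ be a field, and let $E_1/F$ and $E_2/F$ be regular field extensions, i.e. $E_i$ is linearly disjoint over $F$ from the algebraic closure of $F$ (inside an algebraic closure of $E_i$), for $i = 1, 2$. An $F$-variety is a separated scheme of finite type over $F$, and for an $F$-variety $X$ and a field extension $E/F$ we write $X(E)$ for the set of $F$-morphisms $\operatorname{Spec} E \to X$. Suppose that for every geometrically integral smooth affine $F$-variety $X$ we have $$X(E_1) \neq \emptyset \iff X(E_2) \neq \emptyset.$$ Let $\mathcal{L}_{\mathrm{ring}}(F)$ be the language of rings expanded by a constant symbol for each element of $F$, and regard each $E_i$ as an $\mathcal{L}_{\mathrm{ring}}(F)$-structure, the constant symbol of $a \in F$ being interpreted as the image of $a$ in $E_i$. Then $E_1$ and $E_2$ have the same existential $\mathcal{L}_{\mathrm{ring}}(F)$-theory: an existential $\mathcal{L}_{\mathrm{ring}}(F)$-sentence is true in $E_1$ if and only if it is true in $E_2$. -/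

import Mathlib

open CategoryTheory AlgebraicGeometry FirstOrder

universe u v w

/-- A field extension `E / F` is regular if, inside an algebraic closure of `E`, the field `E` is
linearly disjoint over `F` from the algebraic closure of `F`. -/
def IsRegularExtension (F : Type v) (E : Type w) [Field F] [Field E] [Algebra F E] : Prop :=
  (algebraicClosure F (AlgebraicClosure E)).LinearDisjoint E

/-- An `F`-variety is a separated scheme of finite type over the field `F`. -/
structure IsVariety (F : Type u) [Field F] (X : Over (Spec (CommRingCat.of F))) : Prop where
  isSeparated : IsSeparated X.hom
  locallyOfFiniteType : LocallyOfFiniteType X.hom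
  quasiCompact : QuasiCompact X.hom

/-- The geometrically integral smooth affine `F`-varieties. -/
structure IsGeomIntegralSmoothAffineVariety (F : Type u) [Field F]
    (X : Over (Spec (CommRingCat.of F))) : Prop where
  isVariety : IsVariety F X
  isAffine : IsAffine X.left
  smooth : Smooth X.hom
  geometricallyIntegral : GeometricallyIntegral X.hom

/-- The set `X(E)` of `E`-rational points of an `F`-scheme `X`: morphisms `Spec E ⟶ X` over
`Spec F`. -/
def RationalPoints {F : Type u} [Field F] (X : Over (Spec (CommRingCat.of F)))
    (E : Type u) [Field E] [Algebra F E] : Type u :=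
  Over.mk (Spec.map (CommRingCat.ofHom (algebraMap F E))) ⟶ X

/-- An extension `E` of `F` as a structure for the language of rings with a constant for every
element of `F`; the constant of `a` is interpreted as the image of `a` in `E`. -/
@[reducible]
noncomputable def ringOverStructure (F : Type v) (E : Type w) [Field F] [Field E] [Algebra F E] :
    (Language.ring[[F]]).Structure E :=
  letI : Ring.CompatibleRing E := Ring.compatibleRingOfRing E
  letI : (Language.constantsOn F).Structure E :=
    Language.constantsOn.structure (fun a : F => algebraMap F E a)
  Language.withConstantsStructure Language.ring F

/-- The existential theory of `E` in the language of rings with constants for the elements of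
`F`: all existential sentences that are true in `E`. -/
def existentialTheory (F : Type v) (E : Type w) [Field F] [Field E] [Algebra F E] :
    (Language.ring[[F]]).Theory :=
  letI := ringOverStructure F E
  {φ | Language.BoundedFormula.IsExistential φ ∧ E ⊨ φ}

/-!
Truth of an existential sentence in an extension `E₁` of `F` is witnessed inside a finitely
generated `F`-subalgebra `A` of `E₁`: take the `F`-algebra generated by witnesses for the quantified
variables and by the inverses of the nonzero differences `t₁ - t₂` for the equations `t₁ = t₂`
occurring in the sentence. An `F`-algebra homomorphism from `A` to a field `E₂` preserves equations,
and preserves the failing equations too since the corresponding differences are units of `A`. Hence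
the sentence holds in every field extension of `F` that receives a homomorphism from `A`
(`exists_fg_subalgebra_of_mem_existentialTheory`).

It remains to replace `Spec A` by a smooth, geometrically integral open subscheme with an
`E₁`-point, and this is where regularity enters. Let `Ω` be an algebraic closure of `F`.
Regularity says that `Ω ⊗ E₁` is a domain, hence so is `Ω ⊗ B` for every `F`-subalgebra `B` of `E₁`.

* Generic smoothness (`exists_smooth_localizationAway`). Let `L` be the fraction field of `A`. Then
  `Ω ⊗ L` is a domain and integral over `L`, so it is a field, essentially of finite type over the
  perfect field `Ω`, and therefore formally smooth over `Ω`. Vanishing of the first cotangent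
  homology descends along `F → Ω`, so `L` is formally smooth over `F`. In other words, `A` is smooth
  at its generic point, and some localization `A_f` with `f ≠ 0` is smooth over `F`.
* Geometric integrality (`isDomain_tensorProduct_of_isAlgClosure`). Over an algebraically closed
  field, the tensor product of two domains, one of them of finite type, is a domain. Applied to
  `Ω ⊗ A_f` and an algebraic closure of an extension `K` of `F`, this shows that `A_f ⊗ K` is a
  domain.

The inclusion `A_f ⊆ E₁` is an `E₁`-point of `Spec A_f`. So this variety has an `E₂`-point by
hypothesis, which restricts to a homomorphism from `A` to `E₂`.
-/

/-! ### Tensor products of domains over a field, and generic smoothness -/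

open scoped TensorProduct

/-- The weak Nullstellensatz in terms of rational points. -/
lemma exists_algHom_of_isAlgClosed (k R : Type*) [Field k] [IsAlgClosed k] [CommRing R]
    [Algebra k R] [Algebra.FiniteType k R] [Nontrivial R] : Nonempty (R →ₐ[k] k) := by
  obtain ⟨m, hm⟩ := Ideal.exists_maximal R
  let : Field (R ⧸ m) := Ideal.Quotient.field m
  have : Module.Finite k (R ⧸ m) := finite_of_finite_type_of_isJacobsonRing k (R ⧸ m)
  exact ⟨(IsAlgClosed.lift : (R ⧸ m) →ₐ[k] k).comp (Ideal.Quotient.mkₐ k m)⟩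

/-- The `k`-points of an integral affine variety over an algebraically closed field `k` are dense:
no nonzero function vanishes at all of them. -/
lemma exists_algHom_apply_ne_zero {k A : Type*} [Field k] [IsAlgClosed k] [CommRing A]
    [IsDomain A] [Algebra k A] [Algebra.FiniteType k A] {a : A} (ha : a ≠ 0) :
    ∃ f : A →ₐ[k] k, f a ≠ 0 := by
  have : Nontrivial (Localization.Away a) :=
    (IsLocalization.injective (Localization.Away a)
      (powers_le_nonZeroDivisors_of_noZeroDivisors ha)).nontrivial
  have : Algebra.FiniteType A (Localization.Away a) :=
    IsLocalization.finiteType_of_monoid_fg (Submonoid.powers a) _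
  have : Algebra.FiniteType k (Localization.Away a) := .trans (S := A) ‹_› ‹_›
  obtain ⟨g⟩ := exists_algHom_of_isAlgClosed k (Localization.Away a)
  refine ⟨g.comp (IsScalarTower.toAlgHom k A _), ?_⟩
  exact ((IsLocalization.Away.algebraMap_isUnit a).map g).ne_zero

/-- If `x * y = 0` in `A ⊗ B` with `x` and `y` nonzero, expand both in a `k`-basis of `B`. Some
`A`-coordinate of `x` and some `A`-coordinate of `y` are nonzero, hence both are nonzero at a common
`k`-point of `A`. Specializing at this point gives nonzero elements of the domain `B` with
product `0`. -/
lemma isDomain_tensorProduct_of_isAlgClosed (k A B : Type*) [Field k] [IsAlgClosed k]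
    [CommRing A] [IsDomain A] [Algebra k A] [Algebra.FiniteType k A]
    [CommRing B] [IsDomain B] [Algebra k B] : IsDomain (A ⊗[k] B) := by
  let b := Algebra.TensorProduct.basis A (Module.Basis.ofVectorSpace k B)
  -- Specialization at the `k`-point `f` of `A`; it acts on coordinates by applying `f`.
  let ev (f : A →ₐ[k] k) : A ⊗[k] B →ₐ[k] B :=
    Algebra.TensorProduct.lift ((Algebra.ofId k B).comp f) (AlgHom.id k B) fun _ _ ↦ .all _ _
  have hev (f : A →ₐ[k] k) (x : A ⊗[k] B) (i) :
      (Module.Basis.ofVectorSpace k B).repr (ev f x) i = f (b.repr x i) := by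
    induction x with
    | zero => simp
    | add x y hx hy => simp [hx, hy]
    | tmul a y =>
      simp only [ev, b, Algebra.TensorProduct.lift_tmul, AlgHom.comp_apply, Algebra.ofId_apply,
        AlgHom.id_apply, ← Algebra.smul_def, Algebra.TensorProduct.basis_repr_tmul,
        map_smul, Finsupp.smul_apply, Finsupp.mapRange_apply]
      simp
  have : Nontrivial (A ⊗[k] B) := inferInstance
  have : NoZeroDivisors (A ⊗[k] B) := by
    refine ⟨fun {x y} hxy ↦ ?_⟩
    by_contra! h
    obtain ⟨i, hi⟩ : ∃ i, b.repr x i ≠ 0 := by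
      by_contra! H
      exact h.1 (b.repr.map_eq_zero_iff.mp (Finsupp.ext H))
    obtain ⟨j, hj⟩ : ∃ j, b.repr y j ≠ 0 := by
      by_contra! H
      exact h.2 (b.repr.map_eq_zero_iff.mp (Finsupp.ext H))
    obtain ⟨f, hf⟩ := exists_algHom_apply_ne_zero (k := k) (mul_ne_zero hi hj)
    rw [map_mul, ← hev, ← hev] at hf
    rcases mul_eq_zero.mp ((map_mul (ev f) x y).symm.trans (by rw [hxy, map_zero])) with h0 | h0 <;>
      simp [h0] at hf
  exact {}

/-- If a finite type `F`-algebra stays a domain over an algebraic closure of `F`, it stays a domain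
over every field extension of `F`. -/
lemma isDomain_tensorProduct_of_isAlgClosure (F Ω A K : Type*) [Field F] [Field Ω] [Algebra F Ω]
    [IsAlgClosure F Ω] [CommRing A] [Algebra F A] [Algebra.FiniteType F A]
    [IsDomain (Ω ⊗[F] A)] [Field K] [Algebra F K] : IsDomain (A ⊗[F] K) := by
  have : IsAlgClosed Ω := IsAlgClosure.isAlgClosed F
  have : Algebra.IsAlgebraic F Ω := IsAlgClosure.isAlgebraic
  let L := AlgebraicClosure K
  let i : Ω →ₐ[F] L := IsAlgClosed.lift
  let := i.toRingHom.toAlgebra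
  have : IsScalarTower F Ω L := .of_algebraMap_eq fun x ↦ (i.commutes x).symm
  have := isDomain_tensorProduct_of_isAlgClosed Ω (Ω ⊗[F] A) L
  -- `K` embeds into the algebraically closed field `L ⊇ Ω`, and `A ⊗ L` is the base change to `L`
  -- of the `Ω`-algebra `Ω ⊗ A`.
  let e : A ⊗[F] L ≃ₐ[F] (Ω ⊗[F] A) ⊗[Ω] L :=
    (Algebra.TensorProduct.comm F A L).trans <|
      ((Algebra.TensorProduct.cancelBaseChange F Ω Ω L A |>.restrictScalars F).symm).trans <|
      (Algebra.TensorProduct.comm Ω L (Ω ⊗[F] A)).restrictScalars F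
  let g : A ⊗[F] K →ₐ[F] A ⊗[F] L :=
    Algebra.TensorProduct.map (AlgHom.id F A) (IsScalarTower.toAlgHom F K L)
  have hg : Function.Injective g :=
    Module.Flat.lTensor_preserves_injective_linearMap
      (IsScalarTower.toAlgHom F K L).toLinearMap (algebraMap K L).injective
  exact (e.injective.comp hg).isDomain (e.toRingHom.comp g.toRingHom)

lemma isDomain_tensorProduct_of_injective (F Ω : Type*) {A B : Type*} [Field F] [CommRing Ω]
    [Algebra F Ω] [CommRing A] [Algebra F A] [CommRing B] [Algebra F B] [IsDomain (Ω ⊗[F] B)]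
    (f : A →ₐ[F] B) (hf : Function.Injective f) : IsDomain (Ω ⊗[F] A) := by
  have : Function.Injective (Algebra.TensorProduct.map (AlgHom.id F Ω) f) :=
    Module.Flat.lTensor_preserves_injective_linearMap f.toLinearMap hf
  exact this.isDomain (Algebra.TensorProduct.map (AlgHom.id F Ω) f).toRingHom

/-- A finitely generated field extension `L` of `F` such that `Ω ⊗ L` is a domain is formally
smooth: `Ω ⊗ L` is a finitely generated field extension of the perfect field `Ω`, and formal
smoothness descends from `Ω` to `F`. -/
lemma Algebra.FormallySmooth.of_isDomain_tensorProduct (F Ω L : Type*) [Field F] [Field Ω]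
    [Algebra F Ω] [IsAlgClosure F Ω] [Field L] [Algebra F L] [Algebra.EssFiniteType F L]
    [IsDomain (Ω ⊗[F] L)] : Algebra.FormallySmooth F L := by
  have : IsAlgClosed Ω := IsAlgClosure.isAlgClosed F
  have : Algebra.IsAlgebraic F Ω := IsAlgClosure.isAlgebraic
  let : Field (Ω ⊗[F] L) :=
    (Algebra.TensorProduct.isField_of_isAlgebraic F Ω L (.inl inferInstance)).toField
  have hs : Algebra.FormallySmooth Ω (Ω ⊗[F] L) := .of_perfectField
  rw [Algebra.formallySmooth_iff]
  refine ⟨inferInstance, ?_⟩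
  -- Differentials are free over the field `L`, so only the vanishing of `H1Cotangent F L` is at
  -- stake; it can be checked after the faithfully flat base change to `Ω`.
  have : Subsingleton (Ω ⊗[F] Algebra.H1Cotangent F L) :=
    (Algebra.tensorH1CotangentOfFlat F L Ω).subsingleton
  exact Module.FaithfullyFlat.lTensor_reflects_triviality F Ω _

/-- Generic smoothness of a finite type domain whose function field stays a domain over an algebraic
closure of the base field. -/
lemma exists_smooth_localizationAway (F Ω A : Type*) [Field F] [Field Ω] [Algebra F Ω]
    [IsAlgClosure F Ω] [CommRing A] [IsDomain A] [Algebra F A] [Algebra.FiniteType F A]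
    [IsDomain (Ω ⊗[F] FractionRing A)] :
    ∃ f : A, f ≠ 0 ∧ Algebra.Smooth F (Localization.Away f) := by
  have : Algebra.FinitePresentation F A := Algebra.FinitePresentation.of_finiteType.mp ‹_›
  have : Algebra.EssFiniteType A (FractionRing A) := .of_isLocalization _ (nonZeroDivisors A)
  have : Algebra.EssFiniteType F (FractionRing A) := .comp _ A _
  have := Algebra.FormallySmooth.of_isDomain_tensorProduct F Ω (FractionRing A)
  -- The local ring at the generic point is the fraction field.
  have (M : Submonoid A) (hM : M = nonZeroDivisors A) : IsFractionRing A (Localization M) := by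
    subst hM
    infer_instance
  have : IsFractionRing A (Localization.AtPrime (⊥ : Ideal A)) := this _ Ideal.primeCompl_bot
  have : Algebra.IsSmoothAt F (⊥ : Ideal A) :=
    .of_equiv ((IsLocalization.algEquiv (nonZeroDivisors A) (FractionRing A)
      (Localization.AtPrime (⊥ : Ideal A))).restrictScalars F)
  obtain ⟨f, hf, h⟩ := Algebra.IsSmoothAt.exists_notMem_smooth F (⊥ : Ideal A)
  exact ⟨f, by simpa using hf, h⟩

/-! ### Existential sentences and finitely generated subalgebras -/

attribute [local instance] ringOverStructure

open FirstOrder.Language in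
/-- Terms take values in the subalgebra `A` when their variables do, and their evaluation commutes
with `F`-algebra homomorphisms out of `A`. -/
lemma exists_realize_term_eq {F E₁ E₂ : Type*} [Field F] [Field E₁] [Field E₂] [Algebra F E₁]
    [Algebra F E₂] {A : Subalgebra F E₁} (g : A →ₐ[F] E₂) {α : Type*}
    {v₁ : α → E₁} {v₂ : α → E₂} (hv : ∀ i, ∃ a : A, v₁ i = a ∧ v₂ i = g a)
    (t : Language.ring[[F]].Term α) :
    ∃ a : A, t.realize v₁ = a ∧ t.realize v₂ = g a := by
  induction t with
  | var i => exact hv i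
  | @func n f ts ih =>
    choose a ha ha' using ih
    simp only [Term.realize_func, ha, ha']
    rcases f with f | f
    · cases f with
      | add => exact ⟨a 0 + a 1, rfl, (map_add g _ _).symm⟩
      | mul => exact ⟨a 0 * a 1, rfl, (map_mul g _ _).symm⟩
      | neg => exact ⟨-a 0, rfl, (map_neg g _).symm⟩
      | zero => exact ⟨0, rfl, (map_zero g).symm⟩
      | one => exact ⟨1, rfl, (map_one g).symm⟩
    · cases n with
      | zero => exact ⟨algebraMap F A f, rfl, (g.commutes f).symm⟩
      | succ n => exact isEmptyElim f

open FirstOrder.Language in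
/-- A quantifier-free formula keeps its truth value under homomorphisms from an `F`-subalgebra `A`
of `E₁`, as soon as `A` contains a certain finite set `S`: the inverses of `t₁ - t₂` for the
equations `t₁ = t₂` in the formula. -/
lemma exists_finset_realize_iff_of_isQF {F E₁ : Type*} [Field F] [Field E₁] [Algebra F E₁]
    {n : ℕ} {φ : Language.ring[[F]].BoundedFormula Empty n} (hφ : φ.IsQF) (xs : Fin n → E₁) :
    ∃ S : Finset E₁, ∀ (A : Subalgebra F E₁) (_ : (S : Set E₁) ⊆ A) (hxs : ∀ i, xs i ∈ A)
      (E₂ : Type*) [Field E₂] [Algebra F E₂] (g : A →ₐ[F] E₂),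
      φ.Realize default xs ↔ φ.Realize default (fun i ↦ g ⟨xs i, hxs i⟩) := by
  classical
  induction hφ with
  | falsum => exact ⟨∅, fun _ _ _ _ _ _ _ ↦ Iff.rfl⟩
  | of_isAtomic h =>
    cases h with
    | equal t₁ t₂ =>
      -- If `t₁ = t₂` holds, the convention `0⁻¹ = 0` makes the condition on `A` vacuous.
      refine ⟨{(t₁.realize (Sum.elim default xs) - t₂.realize (Sum.elim default xs))⁻¹},
        fun A hS hxs E₂ _ _ g ↦ ?_⟩
      have hv (i : Empty ⊕ Fin n) : ∃ a : A, (Sum.elim default xs i : E₁) = a ∧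
          Sum.elim default (fun i ↦ g ⟨xs i, hxs i⟩) i = g a := by
        rcases i with i | i
        exacts [i.elim, ⟨⟨xs i, hxs i⟩, rfl, rfl⟩]
      obtain ⟨a, ha, ha'⟩ := exists_realize_term_eq g hv t₁
      obtain ⟨b, hb, hb'⟩ := exists_realize_term_eq g hv t₂
      rw [Finset.coe_singleton, Set.singleton_subset_iff, ha, hb] at hS
      rw [BoundedFormula.realize_bdEqual, BoundedFormula.realize_bdEqual, ha, hb, ha', hb',
        SetLike.coe_eq_coe]
      refine ⟨fun h ↦ by rw [h], fun h ↦ ?_⟩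
      by_contra hne
      have hne' : (a : E₁) - b ≠ 0 := sub_ne_zero.mpr fun h ↦ hne (Subtype.ext h)
      -- `a - b` is a unit of `A`, so `g` cannot send it to `0`.
      have hu : (a - b) * ⟨_, hS⟩ = 1 := Subtype.ext (mul_inv_cancel₀ hne')
      have := congr(g $hu)
      rw [map_mul, map_sub, h, sub_self, zero_mul, map_one] at this
      exact zero_ne_one this
    | rel R ts =>
      rcases R with R | R <;> exact isEmptyElim R
  | imp _ _ ih₁ ih₂ =>
    obtain ⟨S₁, h₁⟩ := ih₁
    obtain ⟨S₂, h₂⟩ := ih₂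
    refine ⟨S₁ ∪ S₂, fun A hS hxs E₂ _ _ g ↦ ?_⟩
    rw [Finset.coe_union, Set.union_subset_iff] at hS
    rw [BoundedFormula.realize_imp, BoundedFormula.realize_imp, h₁ A hS.1 hxs E₂ g,
      h₂ A hS.2 hxs E₂ g]

open FirstOrder.Language in
/-- A true existential formula stays true under homomorphisms from any subalgebra containing a
certain finite set, which also holds witnesses of the quantified variables. -/
lemma exists_finset_realize_of_isExistential {F E₁ : Type*} [Field F] [Field E₁] [Algebra F E₁]
    {n : ℕ} {φ : Language.ring[[F]].BoundedFormula Empty n} (hφ : φ.IsExistential) (xs : Fin n → E₁)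
    (h : φ.Realize default xs) :
    ∃ S : Finset E₁, ∀ (A : Subalgebra F E₁) (_ : (S : Set E₁) ⊆ A) (hxs : ∀ i, xs i ∈ A)
      (E₂ : Type*) [Field E₂] [Algebra F E₂] (g : A →ₐ[F] E₂),
      φ.Realize default (fun i ↦ g ⟨xs i, hxs i⟩) := by
  classical
  induction hφ with
  | of_isQF hq =>
    obtain ⟨S, hS⟩ := exists_finset_realize_iff_of_isQF hq xs
    exact ⟨S, fun A hSA hxs E₂ _ _ g ↦ (hS A hSA hxs E₂ g).mp h⟩
  | ex _ ih =>
    obtain ⟨a, ha⟩ := BoundedFormula.realize_ex.mp h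
    obtain ⟨S, hS⟩ := ih (Fin.snoc xs a) ha
    refine ⟨insert a S, fun A hSA hxs E₂ _ _ g ↦ BoundedFormula.realize_ex.mpr ?_⟩
    rw [Finset.coe_insert, Set.insert_subset_iff] at hSA
    refine ⟨g ⟨a, hSA.1⟩, ?_⟩
    have hxs' (i) : (Fin.snoc xs a : _ → E₁) i ∈ A := by
      induction i using Fin.lastCases with
      | last => simpa using hSA.1
      | cast i => simpa using hxs i
    convert hS A hSA.2 hxs' E₂ g using 1
    ext i
    induction i using Fin.lastCases with
    | last => simp
    | cast i => simp

lemma exists_fg_subalgebra_of_mem_existentialTheory {F E₁ : Type u} [Field F] [Field E₁]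
    [Algebra F E₁] {φ : Language.ring[[F]].Sentence} (hφ : φ ∈ existentialTheory F E₁) :
    ∃ A : Subalgebra F E₁, A.FG ∧ ∀ (E₂ : Type u) [Field E₂] [Algebra F E₂],
      Nonempty (A →ₐ[F] E₂) → φ ∈ existentialTheory F E₂ := by
  obtain ⟨hex, hr⟩ := hφ
  obtain ⟨S, hS⟩ := exists_finset_realize_of_isExistential hex default hr
  refine ⟨Algebra.adjoin F S, ⟨S, rfl⟩, fun E₂ _ _ ⟨g⟩ ↦ ⟨hex, ?_⟩⟩
  have := hS _ Algebra.subset_adjoin (fun i ↦ i.elim0) E₂ g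
  rwa [Subsingleton.elim (fun i : Fin 0 ↦ g _) default] at this

/-! ### The variety attached to a finitely generated subalgebra -/

lemma geometricallyIntegral_Spec_map {F A : Type u} [Field F] [CommRing A] [Algebra F A]
    (h : ∀ (K : Type u) [Field K] [Algebra F K], IsDomain (A ⊗[F] K)) :
    GeometricallyIntegral (Spec.map (CommRingCat.ofHom (algebraMap F A))) := by
  refine ⟨geometrically_iff_of_commRing.mpr fun K _ _ Y fst snd hY ↦ ?_⟩
  have := h K
  let e : Y ≅ Spec (.of (A ⊗[F] K)) := hY.isoPullback ≪≫ pullbackSpecIso F A K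
  have : Nonempty Y := (inferInstance : Nonempty (PrimeSpectrum (A ⊗[F] K))).map e.inv
  exact isIntegral_of_isOpenImmersion e.hom

lemma isGeomIntegralSmoothAffineVariety_Spec {F A : Type u} [Field F] [CommRing A] [Algebra F A]
    [Algebra.Smooth F A]
    (h : ∀ (K : Type u) [Field K] [Algebra F K], IsDomain (A ⊗[F] K)) :
    IsGeomIntegralSmoothAffineVariety F
      (Over.mk (Spec.map (CommRingCat.ofHom (algebraMap F A)))) where
  isVariety :=
    { isSeparated := by dsimp; infer_instance
      locallyOfFiniteType := by
        dsimp
        rw [HasRingHomProperty.Spec_iff (P := @LocallyOfFiniteType)]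
        exact RingHom.finiteType_algebraMap.mpr inferInstance
      quasiCompact := by dsimp; infer_instance }
  isAffine := by dsimp; infer_instance
  smooth := by
    dsimp
    rw [HasRingHomProperty.Spec_iff (P := @Smooth)]
    exact RingHom.smooth_algebraMap.mpr inferInstance
  geometricallyIntegral := geometricallyIntegral_Spec_map h

lemma nonempty_rationalPoints_Spec_iff {F A E : Type u} [Field F] [CommRing A] [Algebra F A]
    [Field E] [Algebra F E] :
    Nonempty (RationalPoints (Over.mk (Spec.map (CommRingCat.ofHom (algebraMap F A)))) E) ↔
      Nonempty (A →ₐ[F] E) := by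
  constructor
  · rintro ⟨x⟩
    have hx : x.left ≫ Spec.map (CommRingCat.ofHom (algebraMap F A)) =
      Spec.map (CommRingCat.ofHom (algebraMap F E)) := Over.w x
    obtain ⟨g, hg⟩ := Spec.map_surjective x.left
    rw [← hg, ← Spec.map_comp] at hx
    have := Spec.map_injective hx
    exact ⟨{ g.hom with commutes' := fun r ↦ congr($(this).hom r) }⟩
  · rintro ⟨g⟩
    refine ⟨Over.homMk (Spec.map (CommRingCat.ofHom g.toRingHom)) ?_⟩
    dsimp
    rw [← Spec.map_comp, ← CommRingCat.ofHom_comp]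
    congr
    exact g.comp_algebraMap

lemma IsRegularExtension.isDomain_tensorProduct {F E : Type*} [Field F] [Field E] [Algebra F E]
    (h : IsRegularExtension F E) :
    IsDomain (algebraicClosure F (AlgebraicClosure E) ⊗[F] E) :=
  IntermediateField.LinearDisjoint.isDomain h

/-- For a regular extension `E` of `F`, a finitely generated `F`-subalgebra `A` of `E` has a
localization inside `E` whose spectrum is a geometrically integral smooth affine variety. Its points in
an extension `E'` of `F` restrict to homomorphisms from `A` to `E'`. -/
lemma IsRegularExtension.exists_variety {F E : Type u} [Field F] [Field E] [Algebra F E]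
    (h : IsRegularExtension F E) {A : Subalgebra F E} (hA : A.FG) :
    ∃ X : Over (Spec (CommRingCat.of F)), IsGeomIntegralSmoothAffineVariety F X ∧
      Nonempty (RationalPoints X E) ∧ ∀ (E' : Type u) [Field E'] [Algebra F E'],
        Nonempty (RationalPoints X E') → Nonempty (A →ₐ[F] E') := by
  let Ω := algebraicClosure F (AlgebraicClosure E)
  have : IsDomain (Ω ⊗[F] E) := h.isDomain_tensorProduct
  have : Algebra.FiniteType F A := A.fg_iff_finiteType.mp hA
  have hinj : Function.Injective (algebraMap A E) := Subtype.val_injective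
  have : IsDomain (Ω ⊗[F] FractionRing A) :=
    isDomain_tensorProduct_of_injective F Ω
      (IsFractionRing.liftAlgHom (g := A.val) hinj : FractionRing A →ₐ[F] E)
      (RingHom.injective _)
  obtain ⟨f, hf, hs⟩ := exists_smooth_localizationAway F Ω A
  let B := Localization.Away f
  have hle := powers_le_nonZeroDivisors_of_noZeroDivisors hf
  let ι : B →ₐ[F] E := IsLocalization.liftAlgHom (M := Submonoid.powers f) (f := A.val)
    fun y ↦ (IsUnit.mk0 _ fun h0 ↦ nonZeroDivisors.ne_zero (hle y.2) (Subtype.ext h0))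
  have hι : Function.Injective ι := by
    refine (IsLocalization.lift_injective_iff _).mpr fun x y ↦ ?_
    exact (IsLocalization.injective B hle).eq_iff.trans hinj.eq_iff.symm
  have : IsDomain (Ω ⊗[F] B) := isDomain_tensorProduct_of_injective F Ω ι hι
  refine ⟨_, isGeomIntegralSmoothAffineVariety_Spec (A := B) fun K _ _ ↦
    isDomain_tensorProduct_of_isAlgClosure F Ω B K, nonempty_rationalPoints_Spec_iff.mpr ⟨ι⟩,
    fun E' _ _ h' ↦ ?_⟩
  obtain ⟨g⟩ := nonempty_rationalPoints_Spec_iff.mp h'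
  exact ⟨g.comp (IsScalarTower.toAlgHom F A B)⟩

lemma IsRegularExtension.existentialTheory_subset {F E E' : Type u} [Field F] [Field E]
    [Field E'] [Algebra F E] [Algebra F E'] (hE : IsRegularExtension F E)
    (h : ∀ X : Over (Spec (CommRingCat.of F)), IsGeomIntegralSmoothAffineVariety F X →
      Nonempty (RationalPoints X E) → Nonempty (RationalPoints X E')) :
    existentialTheory F E ⊆ existentialTheory F E' := by
  intro φ hφ
  obtain ⟨A, hA, hmem⟩ := exists_fg_subalgebra_of_mem_existentialTheory hφ
  obtain ⟨X, hX, hXE, hXA⟩ := hE.exists_variety hA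
  exact hmem E' (hXA E' (h X hX hXE))

theorem mainTheorem6 (F E₁ E₂ : Type u) [Field F] [Field E₁] [Field E₂]
    [Algebra F E₁] [Algebra F E₂]
    (h₁ : IsRegularExtension F E₁) (h₂ : IsRegularExtension F E₂)
    (h : ∀ X : Over (Spec (CommRingCat.of F)), IsGeomIntegralSmoothAffineVariety F X →
      (Nonempty (RationalPoints X E₁) ↔ Nonempty (RationalPoints X E₂))) :
    existentialTheory F E₁ = existentialTheory F E₂ := by
  refine Set.Subset.antisymm ?_ ?_
  · exact h₁.existentialTheory_subset fun X hX ↦ (h X hX).mp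
  · exact h₂.existentialTheory_subset fun X hX ↦ (h X hX).mpr
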